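/- Let $d\ge 1$ and let $D$ be a probability distribution on $\mathbb{R}^d$ that is balanced about some point $p\in\mathbb{R}^d$: for every hyperplane through $p$, the two open half-spaces it bounds have equal $D$-measure. For integers $m\ge 1$, $k\ge 0$, let $\mathcal{R}_{m,k,D}$ be the random coloured family of $k$ labelled points that are i.i.d. with law $D$, each coloured, independently of everything else, with one of $m$ colours chosen uniformly. It is called Tverberg with tolerance $t$ if, after the removal of any at most $t$ of the $k$ points, the convex hulls of the $m$ colour classes have a common point, and Tverberg if this holds with $t=0$. When balls are thrown independently and uniformly into $m$ urns, let $N_n(m)$ be the number of throws necessary to obtain at least $n$ balls in each urn. 1. For all integers $m,n\ge 1$ and $k,t\ge 0$, $$\mathbb{P}(\mathcal{R}_{m,k,D}\text{ is Tverberg with tolerance }t)\ \ge\ \mathbb{P}(N_n(m)\le k)\left(1-2^{-\lfloor n/(2d)\rfloor}\sum_{i=0}^{t}\binom{\lfloor n/(2d)\rfloor}{i}\right)^m .$$ 2. For all integers $m,n\ge 1$ and $k\ge 0$, $$\mathbb{P}(\mathcal{R}_{m,k,D}\text{ is Tverberg})\ \ge\ \mathbb{P}(N_n(m)\le k)\left(1-2^{-n+1}\sum_{i=0}^{d-1}\binom{n-1}{i}\right)^m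 .$$ 3. If $f:\mathbb{N}\to\mathbb{N}$ satisfies $f(m)\gg m\log_2(m)\ln(\ln(m))$, that is, $m\log_2(m)\ln(\ln(m))=o(f(m))$ as $m\to\infty$, then $\mathcal{R}_{m,f(m),D}$ is Tverberg with high probability, that is, $$\lim_{m\to\infty}\mathbb{P}(\mathcal{R}_{m,f(m),D}\text{ is Tverberg})=1 .$$ -/

import Mathlib

open MeasureTheory ProbabilityTheory Filter Topology Asymptotics

namespace StochasticTverberg

/-- `D` is balanced about `p`: for every hyperplane through `p` (with normal vector `u`), the two
open half-spaces it bounds have the same `D`-measure. -/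
def IsBalancedAbout {d : ℕ} (D : Measure (EuclideanSpace ℝ (Fin d)))
    (p : EuclideanSpace ℝ (Fin d)) : Prop :=
  ∀ u : EuclideanSpace ℝ (Fin d), u ≠ 0 →
    D {x | 0 < inner ℝ u (x - p)} = D {x | inner ℝ u (x - p) < 0}

/-- A family of `k` labelled points of `ℝ^d`, each with one of `m` colours. -/
abbrev ColoredPoints (d m k : ℕ) : Type := Fin k → EuclideanSpace ℝ (Fin d) × Fin m

/-- The points of colour `j` that are left after the points with labels in `R` are removed. -/
def remainingClass {d m k : ℕ} (ω : ColoredPoints d m k) (R : Finset (Fin k)) (j : Fin m) :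
    Set (EuclideanSpace ℝ (Fin d)) :=
  {x | ∃ i : Fin k, i ∉ R ∧ (ω i).2 = j ∧ (ω i).1 = x}

/-- The colour classes form a Tverberg partition with tolerance `t`: after the removal of any (at
most) `t` of the points, the convex hulls of all the colour classes have a common point. -/
def IsTverbergWithTolerance {d m k : ℕ} (t : ℕ) (ω : ColoredPoints d m k) : Prop :=
  ∀ R : Finset (Fin k), R.card ≤ t →
    (⋂ j : Fin m, convexHull ℝ (remainingClass ω R j)).Nonempty

/-- The colour classes form a Tverberg partition: all their convex hulls have a common point. -/
def IsTverberg {d m k : ℕ} (ω : ColoredPoints d m k) : Prop :=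
  (⋂ j : Fin m, convexHull ℝ (remainingClass ω ∅ j)).Nonempty

/-- The uniform distribution on `m` colours (or urns). -/
noncomputable def uniformColor (m : ℕ) : Measure (Fin m) := uniformOn Set.univ

/-- The random allocation model: `k` independent points with law `D`, each coloured
independently and uniformly with one of `m` colours. -/
noncomputable def randomAllocation (m k : ℕ) {d : ℕ} (D : Measure (EuclideanSpace ℝ (Fin d))) :
    Measure (ColoredPoints d m k) :=
  Measure.pi fun _ : Fin k => D.prod (uniformColor m)

/-- The law of an infinite sequence of independent uniform throws of balls into `m` urns. -/
noncomputable def urnThrows (m : ℕ) : Measure (ℕ → Fin m) :=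
  Measure.infinitePi fun _ : ℕ => uniformColor m

/-- The number of balls in urn `j` after the first `r` throws. -/
def urnLoad {m : ℕ} (ω : ℕ → Fin m) (r : ℕ) (j : Fin m) : ℕ :=
  ((Finset.range r).filter fun i => ω i = j).card

/-- `N_n(m)`: the number of throws necessary to obtain at least `n` balls in each of the `m` urns
(`⊤` if this never happens). -/
noncomputable def throwsNeeded {m : ℕ} (n : ℕ) (ω : ℕ → Fin m) : ℕ∞ :=
  ⨅ (r : ℕ) (_ : ∀ j : Fin m, n ≤ urnLoad ω r j), (r : ℕ∞)

end StochasticTverberg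

/-! The centre `p` itself serves as the common point of the hulls. Balance says that every open
half-space at `p` has the mass of its opposite. Averaging this over Gaussian normal vectors shows
that the directions of the points seen from `p` have a centrally symmetric law
(`map_inv_norm_smul_neg_of_balanced`). Whether a sample lies in an open half-space at `p` depends on
these directions only, and under a symmetric law each point may be given an arbitrary sign without
changing probabilities. So Wendel's argument applies: average over all signs and count the good ones
with Schläfli's bound (`card_signPatterns_le`). The result is
`IsBalancedAbout.measureReal_not_surrounds_le`.

Colours and positions are independent. Once a colouring uses each colour at least `n` times, fix `n`
labels of each colour; the `m` resulting samples are independent, so the probability is at least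
P(N_n(m) ≤ k) times `q ^ m`, where `q` is the chance that one sample of `n` points surrounds `p`
robustly enough (`randomAllocation_lower_bound`). Without tolerance, Wendel's inequality bounds `q`.
With tolerance `t`, cut the `n` points into blocks of `2 * d`: each surrounds `p` with probability
at least 1/2, and `t` removals spoil at most `t` blocks, which leaves a binomial tail. The limit
statement takes `n = 2 * Nat.clog 2 m + 1`, with a Chernoff bound for the urns. -/

namespace StochasticTverberg

/-! ### Central symmetry of the directions under a balanced law. -/

section Symmetry

theorem integral_mul_polynomial_exp_eq_zero {Ω : Type*} [MeasurableSpace Ω] {μ : Measure Ω}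
    [IsFiniteMeasure μ] {Y : Ω → ℝ} (hY : Measurable Y) {M : ℝ} (hM : ∀ ω, |Y ω| ≤ M)
    (h : ∀ k : ℕ, ∫ ω, Y ω * Real.exp (-(k * Y ω ^ 2)) ∂μ = 0) (p : Polynomial ℝ) :
    ∫ ω, Y ω * p.eval (Real.exp (-Y ω ^ 2)) ∂μ = 0 := by
  have key : ∀ ω, Y ω * p.eval (Real.exp (-Y ω ^ 2)) =
      ∑ k ∈ Finset.range (p.natDegree + 1), p.coeff k * (Y ω * Real.exp (-(k * Y ω ^ 2))) := by
    intro ω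
    rw [Polynomial.eval_eq_sum_range, Finset.mul_sum]
    refine Finset.sum_congr rfl fun k _ => ?_
    rw [← Real.exp_nat_mul, mul_neg]
    ring
  simp_rw [key]
  rw [integral_finsetSum]
  · refine Finset.sum_eq_zero fun k _ => ?_
    rw [integral_const_mul, h k, mul_zero]
  · intro k _
    refine Integrable.const_mul (Integrable.of_bound (C := M) (by fun_prop) ?_) _
    refine Eventually.of_forall fun ω => ?_
    rw [norm_mul, Real.norm_eq_abs, Real.norm_eq_abs, Real.abs_exp]
    have h1 : Real.exp (-(k * Y ω ^ 2)) ≤ 1 := Real.exp_le_one_iff.2 (by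
      have : 0 ≤ (k : ℝ) * Y ω ^ 2 := by positivity
      linarith)
    nlinarith [hM ω, abs_nonneg (Y ω), Real.exp_pos (-(k * Y ω ^ 2))]

theorem mul_sinc_sqrt_log (y : ℝ) :
    y * Real.sinc (√(-Real.log (Real.exp (-y ^ 2)))) = Real.sin y := by
  rw [Real.log_exp, neg_neg, Real.sqrt_sq_eq_abs]
  have : Real.sinc |y| = Real.sinc y := by
    rcases abs_choice y with h | h <;> rw [h]
    exact Real.sinc_neg y
  rw [this]
  rcases eq_or_ne y 0 with rfl | hy
  · simp
  · rw [Real.sinc_of_ne_zero hy]; field_simp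

/-- As sinc is even, sin y is y times a continuous function of w = exp(-y²) (`mul_sinc_sqrt_log`).
On the compact range of w, Weierstrass replaces that function by a polynomial, for which the
integral vanishes. -/
theorem integral_sin_eq_zero_of_moments {Ω : Type*} [MeasurableSpace Ω] {μ : Measure Ω}
    [IsFiniteMeasure μ] {Y : Ω → ℝ} (hY : Measurable Y) {M : ℝ} (hM : ∀ ω, |Y ω| ≤ M)
    (h : ∀ k : ℕ, ∫ ω, Y ω * Real.exp (-(k * Y ω ^ 2)) ∂μ = 0) :
    ∫ ω, Real.sin (Y ω) ∂μ = 0 := by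
  set f : ℝ → ℝ := fun w => Real.sinc (√(-Real.log w)) with hf
  have hfc : ContinuousOn f (Set.Icc (Real.exp (-M ^ 2)) 1) := by
    refine Real.continuous_sinc.comp_continuousOn (Real.continuous_sqrt.comp_continuousOn ?_)
    refine (Real.continuousOn_log.mono fun w hw => ?_).neg
    exact ne_of_gt ((Real.exp_pos _).trans_le hw.1)
  have hW : ∀ ω, Real.exp (-Y ω ^ 2) ∈ Set.Icc (Real.exp (-M ^ 2)) 1 := by
    intro ω
    refine ⟨Real.exp_le_exp.2 (neg_le_neg ?_), Real.exp_le_one_iff.2 (by nlinarith)⟩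
    exact sq_le_sq' (by linarith [neg_abs_le (Y ω), hM ω]) ((le_abs_self _).trans (hM ω))
  set K : ℝ := |M| * μ.real Set.univ with hK
  have hsin : Integrable (fun ω => Real.sin (Y ω)) μ :=
    Integrable.of_bound (C := 1) (by fun_prop)
      (Eventually.of_forall fun ω => by simpa using Real.abs_sin_le_one _)
  have bound : ∀ ε > 0, |∫ ω, Real.sin (Y ω) ∂μ| ≤ ε * K := by
    intro ε hε
    obtain ⟨p, hp⟩ := exists_polynomial_near_of_continuousOn _ _ f hfc ε hε
    have h0 := integral_mul_polynomial_exp_eq_zero hY hM h p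
    have hb : ∀ ω, ‖Real.sin (Y ω) - Y ω * p.eval (Real.exp (-Y ω ^ 2))‖ ≤ |M| * ε := by
      intro ω
      rw [← mul_sinc_sqrt_log, ← mul_sub, norm_mul, Real.norm_eq_abs, Real.norm_eq_abs,
        abs_sub_comm]
      exact mul_le_mul ((hM ω).trans (le_abs_self M)) (hp _ (hW ω)).le (abs_nonneg _) (abs_nonneg _)
    have hm : Measurable fun ω => Real.sin (Y ω) - Y ω * p.eval (Real.exp (-Y ω ^ 2)) := by
      have := p.continuous.measurable
      fun_prop
    have hd : Integrable (fun ω => Real.sin (Y ω) - Y ω * p.eval (Real.exp (-Y ω ^ 2))) μ :=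
      Integrable.of_bound hm.aestronglyMeasurable (C := |M| * ε) (Eventually.of_forall hb)
    have h1 : Integrable (fun ω => Y ω * p.eval (Real.exp (-Y ω ^ 2))) μ := by
      refine (hsin.sub hd).congr (Eventually.of_forall fun ω => ?_)
      simp
    have h2 : ∫ ω, Real.sin (Y ω) ∂μ =
        ∫ ω, (Real.sin (Y ω) - Y ω * p.eval (Real.exp (-Y ω ^ 2))) ∂μ := by
      rw [integral_sub hsin h1, h0, sub_zero]
    rw [h2]
    refine (norm_integral_le_of_norm_le_const (Eventually.of_forall hb)).trans (le_of_eq ?_)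
    rw [hK]; ring
  by_contra hne
  have hpos : 0 < |∫ ω, Real.sin (Y ω) ∂μ| := abs_pos.2 hne
  have hK0 : 0 ≤ K := by positivity
  -- This ε makes the bound at most half the integral; `K + 1` guards against `K = 0`.
  have := bound (|∫ ω, Real.sin (Y ω) ∂μ| / (2 * (K + 1))) (by positivity)
  rw [div_mul_eq_mul_div, le_div_iff₀ (by positivity)] at this
  nlinarith

theorem hasDerivAt_integral_symm {g : ℝ → ℝ} (hg : Continuous g) (y : ℝ) :
    HasDerivAt (fun c : ℝ => ∫ t in (-c)..c, g t) (g y + g (-y)) y := by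
  have h1 : HasDerivAt (fun c : ℝ => ∫ t in (0)..c, g t) (g y) y :=
    intervalIntegral.integral_hasDerivAt_right (hg.intervalIntegrable _ _)
      (hg.stronglyMeasurableAtFilter _ _) hg.continuousAt
  have h2 : HasDerivAt (fun c : ℝ => ∫ t in (0)..(-c), g t) (g (-y) * (-1)) y :=
    HasDerivAt.comp y (h₂ := fun c : ℝ => ∫ t in (0)..c, g t) (h := fun c => -c)
      (intervalIntegral.integral_hasDerivAt_right (hg.intervalIntegrable _ _)
      (hg.stronglyMeasurableAtFilter _ _) hg.continuousAt) (hasDerivAt_neg y)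
  convert! h1.sub h2 using 1
  · ext c
    exact (intervalIntegral.integral_interval_sub_left (hg.intervalIntegrable _ _)
      (hg.intervalIntegrable _ _)).symm
  · ring

/-- Differentiating the hypothesis in `s` gives ∫ 2 Y g(sY) = 0 with g the normal density, that is,
∫ Y exp(-s²Y²/2) = 0. -/
theorem integral_sin_eq_zero_of_gaussian {Ω : Type*} [MeasurableSpace Ω] {μ : Measure Ω}
    [IsFiniteMeasure μ] {Y : Ω → ℝ} (hY : Measurable Y) {M : ℝ} (hM : ∀ ω, |Y ω| ≤ M)
    (h : ∀ s : ℝ, ∫ ω, (∫ t in (-(s * Y ω))..(s * Y ω), gaussianPDFReal 0 1 t) ∂μ = 0) :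
    ∫ ω, Real.sin (Y ω) ∂μ = 0 := by
  refine integral_sin_eq_zero_of_moments hY hM fun k => ?_
  set g : ℝ → ℝ := gaussianPDFReal 0 1 with hg
  have hgform : ∀ y, g y = (√(2 * Real.pi))⁻¹ * Real.exp (-(y ^ 2 / 2)) := by
    intro y; simp [hg, gaussianPDFReal, neg_div]
  have hgc : Continuous g := by
    have : g = fun y => (√(2 * Real.pi))⁻¹ * Real.exp (-(y ^ 2 / 2)) := funext hgform
    rw [this]; fun_prop
  set H : ℝ → ℝ := fun c => ∫ t in (-c)..c, g t with hH
  have hHd : ∀ y, HasDerivAt H (2 * g y) y := by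
    intro y
    convert! hasDerivAt_integral_symm hgc y using 1
    simp only [hgform, neg_sq]; ring
  have hHc : Continuous H := continuous_iff_continuousAt.2 fun y => (hHd y).continuousAt
  set C : ℝ := (√(2 * Real.pi))⁻¹ with hC
  have hC0 : 0 < C := by positivity
  have hgle : ∀ y, |g y| ≤ C := by
    intro y
    rw [hgform, abs_mul, Real.abs_exp, abs_of_pos hC0]
    have : Real.exp (-(y ^ 2 / 2)) ≤ 1 := Real.exp_le_one_iff.2 (by nlinarith [sq_nonneg y])
    nlinarith
  have hM0 : ∀ ω, 0 ≤ M := fun ω => (abs_nonneg _).trans (hM ω)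
  -- At `s = √(2 * k)` the exponent s²Y²/2 becomes `k * Y ^ 2`.
  have hder := (hasDerivAt_integral_of_dominated_loc_of_deriv_le (μ := μ)
    (F := fun s ω => H (s * Y ω)) (F' := fun s ω => 2 * g (s * Y ω) * Y ω)
    (bound := fun _ => 2 * C * M) (x₀ := √(2 * k)) (s := Set.univ) Filter.univ_mem
    (Eventually.of_forall fun s =>
      (hHc.measurable.comp (measurable_const.mul hY)).aestronglyMeasurable)
    ?_ ?_ ?_ (integrable_const _) ?_).2
  · have h0 : (fun s => ∫ ω, H (s * Y ω) ∂μ) = fun _ => 0 := funext h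
    rw [h0] at hder
    have h1 := hder.unique (hasDerivAt_const _ _)
    have h2 : ∀ ω, 2 * g (√(2 * k) * Y ω) * Y ω =
        (2 * C) * (Y ω * Real.exp (-(k * Y ω ^ 2))) := by
      intro ω
      rw [hgform, mul_pow, Real.sq_sqrt (by positivity),
        show (2 * (k : ℝ) * Y ω ^ 2 / 2) = k * Y ω ^ 2 by ring]
      ring
    simp_rw [h2] at h1
    rw [integral_const_mul] at h1
    exact (mul_eq_zero.1 h1).resolve_left (by positivity)
  · obtain ⟨B, hB⟩ := (isCompact_Icc (a := -(√(2 * k) * M)) (b := √(2 * k) * M)).exists_bound_of_continuousOn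
      hHc.continuousOn
    refine Integrable.of_bound (C := B)
      (hHc.measurable.comp (measurable_const.mul hY)).aestronglyMeasurable
      (Eventually.of_forall fun ω => hB _ (abs_le.1 ?_))
    rw [abs_mul, abs_of_nonneg (Real.sqrt_nonneg _)]
    exact mul_le_mul_of_nonneg_left (hM ω) (Real.sqrt_nonneg _)
  · exact (((hgc.measurable.comp (measurable_const.mul hY)).const_mul 2).mul hY).aestronglyMeasurable
  · refine Eventually.of_forall fun ω s _ => ?_
    rw [norm_mul, norm_mul, Real.norm_eq_abs, Real.norm_eq_abs, Real.norm_eq_abs, abs_two]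
    exact mul_le_mul (by linarith [hgle (s * Y ω)]) (hM ω) (abs_nonneg _) (by positivity)
  · refine Eventually.of_forall fun ω s _ => ?_
    exact HasDerivAt.comp s (h₂ := H) (h := fun s => s * Y ω) (hHd _)
      (by simpa using (hasDerivAt_id s).mul_const (Y ω))

theorem gaussianReal_real_Ioi_neg (c : ℝ) :
    (gaussianReal 0 1).real (Set.Ioi (-c)) = (gaussianReal 0 1).real (Set.Iic c) := by
  have h : (gaussianReal 0 1).map (fun x => -x) = gaussianReal 0 1 := by
    rw [gaussianReal_map_neg, neg_zero]
  have : (gaussianReal 0 1) (Set.Ioi (-c)) = (gaussianReal 0 1) (Set.Iio c) := by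
    conv_lhs => rw [← h]
    rw [Measure.map_apply measurable_neg measurableSet_Ioi]
    congr 1
    ext x
    simp
  have : NullSingletonClass (gaussianReal 0 1) := nullSingletonClass_gaussianReal one_ne_zero
  rw [measureReal_def, measureReal_def, ‹(gaussianReal 0 1) (Set.Ioi (-c)) = _›]
  rw [measure_congr Iio_ae_eq_Iic]

theorem gaussianReal_real_sub (c : ℝ) :
    (gaussianReal 0 1).real (Set.Ioi (-c)) - (gaussianReal 0 1).real (Set.Iio (-c)) =
      ∫ t in (-c)..c, gaussianPDFReal 0 1 t := by
  have : NullSingletonClass (gaussianReal 0 1) := nullSingletonClass_gaussianReal one_ne_zero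
  have h : ∀ a, (gaussianReal 0 1).real (Set.Iic a) = ∫ t in Set.Iic a, gaussianPDFReal 0 1 t := by
    intro a
    rw [measureReal_def, gaussianReal_apply_eq_integral 0 one_ne_zero, ENNReal.toReal_ofReal]
    exact integral_nonneg fun t => gaussianPDFReal_nonneg _ _ _
  have h2 : (gaussianReal 0 1).real (Set.Iio (-c)) = (gaussianReal 0 1).real (Set.Iic (-c)) := by
    rw [measureReal_def, measureReal_def, measure_congr Iio_ae_eq_Iic]
  rw [gaussianReal_real_Ioi_neg, h2, h, h]
  exact intervalIntegral.integral_Iic_sub_Iic (integrable_gaussianPDFReal 0 1).integrableOn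
    (integrable_gaussianPDFReal 0 1).integrableOn

variable {E : Type*} [NormedAddCommGroup E] [InnerProductSpace ℝ E] [FiniteDimensional ℝ E]
  [MeasurableSpace E] [BorelSpace E]

theorem stdGaussian_map_inner {x : E} (hx : ‖x‖ = 1) :
    (stdGaussian E).map (fun u => inner ℝ u x) = gaussianReal 0 1 := by
  have h := IsGaussian.map_eq_gaussianReal (μ := stdGaussian E) (innerSL ℝ x)
  rw [variance_dual_stdGaussian, integral_strongDual_stdGaussian, innerSL_apply_norm, hx] at h
  have : (fun u => inner ℝ u x) = (innerSL ℝ x : E → ℝ) := by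
    ext u; simp [real_inner_comm]
  rw [this, h]; simp

omit [FiniteDimensional ℝ E] [MeasurableSpace E] [BorelSpace E] in
theorem inner_inv_norm_smul_pos_iff (u x : E) : 0 < inner ℝ u (‖x‖⁻¹ • x) ↔ 0 < inner ℝ u x := by
  rcases eq_or_ne x 0 with rfl | hx
  · simp
  · rw [real_inner_smul_right]
    exact mul_pos_iff_of_pos_left (inv_pos.2 (norm_pos_iff.2 hx))

omit [FiniteDimensional ℝ E] [MeasurableSpace E] [BorelSpace E] in
theorem inner_inv_norm_smul_neg_iff (u x : E) : inner ℝ u (‖x‖⁻¹ • x) < 0 ↔ inner ℝ u x < 0 := by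
  rcases eq_or_ne x 0 with rfl | hx
  · simp
  · rw [real_inner_smul_right]
    exact ⟨fun h => neg_of_mul_neg_right h (inv_pos.2 (norm_pos_iff.2 hx)).le,
      fun h => mul_neg_of_pos_of_neg (inv_pos.2 (norm_pos_iff.2 hx)) h⟩

/-- For a unit vector e and Gaussian u, the inner product of u + s • a with e is a standard normal
shifted by s⟨a, e⟩. This rewrites the integral in `integral_sin_eq_zero_of_gaussian` through random
half-spaces. For `x = 0` both sides vanish. -/
theorem stdGaussian_real_halfspace_sub (a x : E) (s : ℝ) :
    (stdGaussian E).real {u | 0 < inner ℝ (u + s • a) (‖x‖⁻¹ • x)} -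
      (stdGaussian E).real {u | inner ℝ (u + s • a) (‖x‖⁻¹ • x) < 0} =
    ∫ t in (-(s * inner ℝ a (‖x‖⁻¹ • x)))..(s * inner ℝ a (‖x‖⁻¹ • x)),
      gaussianPDFReal 0 1 t := by
  rcases eq_or_ne x 0 with rfl | hx
  · simp
  have hn : ‖‖x‖⁻¹ • x‖ = 1 := norm_smul_inv_norm (𝕜 := ℝ) hx
  rw [← gaussianReal_real_sub, ← stdGaussian_map_inner hn,
    map_measureReal_apply (by fun_prop) measurableSet_Ioi,
    map_measureReal_apply (by fun_prop) measurableSet_Iio]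
  congr 2 <;> congr 1 <;> ext u <;>
    simp only [Set.mem_Ioi, Set.mem_Iio, inner_add_left,
      inner_smul_left (𝕜 := ℝ), RCLike.conj_to_real] <;>
    constructor <;> intro h <;> linarith

/-- Fubini for a Gaussian u and a ν-random x: for fixed u the two half-spaces with normal u + s • a
have equal ν-mass, while for fixed x the difference of the two masses is the symmetric Gaussian
integral. -/
theorem integral_sin_inner_eq_zero_of_balanced (ν : Measure E) [IsProbabilityMeasure ν]
    (hν : ∀ u : E, ν {x | 0 < inner ℝ u x} = ν {x | inner ℝ u x < 0}) (a : E) :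
    ∫ x, Real.sin (inner ℝ a (‖x‖⁻¹ • x)) ∂ν = 0 := by
  refine integral_sin_eq_zero_of_gaussian (M := ‖a‖) (by fun_prop) (fun x => ?_) fun s => ?_
  · refine (abs_real_inner_le_norm _ _).trans ?_
    have : ‖‖x‖⁻¹ • x‖ ≤ 1 := by
      rw [norm_smul, norm_inv, norm_norm]
      exact inv_mul_le_one
    nlinarith [norm_nonneg a]
  have hA : MeasurableSet {z : E × E | 0 < inner ℝ (z.1 + s • a) (‖z.2‖⁻¹ • z.2)} :=
    measurableSet_lt (by fun_prop) (by fun_prop)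
  have hB : MeasurableSet {z : E × E | inner ℝ (z.1 + s • a) (‖z.2‖⁻¹ • z.2) < 0} :=
    measurableSet_lt (by fun_prop) (by fun_prop)
  have hAB : ((stdGaussian E).prod ν) {z : E × E | 0 < inner ℝ (z.1 + s • a) (‖z.2‖⁻¹ • z.2)} =
      ((stdGaussian E).prod ν) {z : E × E | inner ℝ (z.1 + s • a) (‖z.2‖⁻¹ • z.2) < 0} := by
    rw [Measure.prod_apply hA, Measure.prod_apply hB]
    refine lintegral_congr fun u => ?_
    simp only [Set.preimage_ofPred_eq, inner_inv_norm_smul_pos_iff, inner_inv_norm_smul_neg_iff]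
    exact hν _
  have key : ∀ S : Set (E × E), MeasurableSet S →
      Integrable (fun x => (stdGaussian E).real ((fun u => (u, x)) ⁻¹' S)) ν ∧
      ∫ x, (stdGaussian E).real ((fun u => (u, x)) ⁻¹' S) ∂ν = (((stdGaussian E).prod ν) S).toReal := by
    intro S hS
    have hm : Measurable fun x => (stdGaussian E) ((fun u => (u, x)) ⁻¹' S) :=
      measurable_measure_prodMk_right hS
    constructor
    · refine Integrable.of_bound (C := 1) hm.ennreal_toReal.aestronglyMeasurable
        (Eventually.of_forall fun x => ?_)
      rw [Real.norm_of_nonneg measureReal_nonneg]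
      exact measureReal_le_one
    · rw [Measure.prod_apply_symm hS, ← integral_toReal hm.aemeasurable
        (Eventually.of_forall fun x => measure_lt_top _ _)]
      rfl
  simp_rw [← stdGaussian_real_halfspace_sub]
  refine (integral_sub (key _ hA).1 (key _ hB).1).trans ?_
  exact sub_eq_zero.2 ((key _ hA).2.trans ((congrArg _ hAB).trans (key _ hB).2.symm))

/-- A distribution that gives opposite open half-spaces the same mass is centrally symmetric after
radial projection to the sphere. -/
theorem map_inv_norm_smul_neg_of_balanced (ν : Measure E) [IsProbabilityMeasure ν]
    (hν : ∀ u : E, ν {x | 0 < inner ℝ u x} = ν {x | inner ℝ u x < 0}) :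
    (ν.map fun x => ‖x‖⁻¹ • x).map (fun x => -x) = ν.map fun x => ‖x‖⁻¹ • x := by
  have hm : Measurable fun x : E => ‖x‖⁻¹ • x := by fun_prop
  have : IsProbabilityMeasure (ν.map fun x => ‖x‖⁻¹ • x) :=
    Measure.isProbabilityMeasure_map hm.aemeasurable
  refine Measure.ext_of_charFun (funext fun a => ?_)
  have h1 : charFun ((ν.map fun x => ‖x‖⁻¹ • x).map (fun x => -x)) a =
      charFun (ν.map fun x => ‖x‖⁻¹ • x) (-a) := by
    rw [charFun_apply, charFun_apply, integral_map (by fun_prop) (by fun_prop)]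
    simp
  -- Reflection conjugates the characteristic function, so symmetry means that its imaginary part,
  -- the integral of the sine, vanishes.
  rw [h1, charFun_neg, Complex.conj_eq_iff_im, charFun_apply, integral_map hm.aemeasurable
    (by fun_prop)]
  have hi : Integrable (fun x : E => Complex.exp (inner ℝ (‖x‖⁻¹ • x) a * Complex.I)) ν := by
    refine Integrable.of_bound (C := 1) (by fun_prop) (Eventually.of_forall fun x => ?_)
    rw [Complex.norm_exp_ofReal_mul_I]
  have h2 := integral_im hi
  simp only [RCLike.im_to_complex, Complex.exp_ofReal_mul_I_im] at h2
  rw [← h2, ← integral_sin_inner_eq_zero_of_balanced ν hν a]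
  simp_rw [real_inner_comm]

end Symmetry
-- Counting the regions of a central hyperplane arrangement.
section SignPatterns

/-- The sign encoded by a Boolean. -/
def boolSign (b : Bool) : ℝ := if b then 1 else -1

open Classical in
/-- The sign patterns `ε` for which some vector is strictly positive on all `ε i • f i`. -/
noncomputable def signPatterns {V : Type*} [AddCommGroup V] [Module ℝ V] {n : ℕ}
    (f : Fin n → V →ₗ[ℝ] ℝ) : Finset (Fin n → Bool) :=
  Finset.univ.filter fun ε => ∃ u : V, ∀ i, 0 < boolSign (ε i) * f i u

theorem mem_signPatterns {V : Type*} [AddCommGroup V] [Module ℝ V] {n : ℕ}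
    {f : Fin n → V →ₗ[ℝ] ℝ} {ε : Fin n → Bool} :
    ε ∈ signPatterns f ↔ ∃ u : V, ∀ i, 0 < boolSign (ε i) * f i u := by
  simp [signPatterns]

theorem signPatterns_eq_empty {V : Type*} [AddCommGroup V] [Module ℝ V] {n : ℕ}
    {f : Fin n → V →ₗ[ℝ] ℝ} {i : Fin n} (hi : f i = 0) : signPatterns f = ∅ := by
  refine Finset.eq_empty_of_forall_notMem fun ε hε => ?_
  obtain ⟨u, hu⟩ := mem_signPatterns.1 hε
  simpa [hi] using hu i

/-- Deletion and restriction: a pattern of the remaining forms extends by at least one sign of `f 0`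
if it is counted at all, and if it extends by both signs then it is realised on the hyperplane `f 0
= 0`. -/
theorem card_signPatterns_succ_le {V : Type*} [AddCommGroup V] [Module ℝ V] {n : ℕ}
    (f : Fin (n + 1) → V →ₗ[ℝ] ℝ) :
    (signPatterns f).card ≤ (signPatterns fun i : Fin n => f i.succ).card +
      (signPatterns fun i : Fin n => (f i.succ).domRestrict (LinearMap.ker (f 0))).card := by
  classical
  let A : Bool → Finset (Fin n → Bool) := fun b =>
    Finset.univ.filter fun ε => (Fin.cons b ε : Fin (n + 1) → Bool) ∈ signPatterns f
  have hsplit : (signPatterns f).card ≤ (A true).card + (A false).card := by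
    have hinj : ∀ b, Function.Injective fun ε : Fin n → Bool => (Fin.cons b ε : Fin (n + 1) → Bool) :=
      fun b => Fin.cons_right_injective (α := fun _ => Bool) b
    have : signPatterns f ⊆ (A true).image (fun ε => (Fin.cons true ε : Fin (n + 1) → Bool)) ∪
        (A false).image (fun ε => (Fin.cons false ε : Fin (n + 1) → Bool)) := by
      intro ε hε
      rw [Finset.mem_union, Finset.mem_image, Finset.mem_image]
      rcases h : ε 0 with _ | _
      · right
        refine ⟨Fin.tail ε, ?_, ?_⟩
        · simp only [A, Finset.mem_filter, Finset.mem_univ, true_and]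
          rwa [← h, Fin.cons_self_tail]
        · rw [← h, Fin.cons_self_tail]
      · left
        refine ⟨Fin.tail ε, ?_, ?_⟩
        · simp only [A, Finset.mem_filter, Finset.mem_univ, true_and]
          rwa [← h, Fin.cons_self_tail]
        · rw [← h, Fin.cons_self_tail]
    refine (Finset.card_le_card this).trans ((Finset.card_union_le _ _).trans ?_)
    exact add_le_add Finset.card_image_le Finset.card_image_le
  refine hsplit.trans ?_
  rw [← Finset.card_union_add_card_inter]
  have hA : ∀ {b ε}, ε ∈ A b → ∃ u : V, 0 < boolSign b * f 0 u ∧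
      ∀ i : Fin n, 0 < boolSign (ε i) * f i.succ u := by
    intro b ε hε
    simp only [A, Finset.mem_filter, Finset.mem_univ, true_and] at hε
    obtain ⟨u, hu⟩ := mem_signPatterns.1 hε
    exact ⟨u, by simpa using hu 0, fun i => by simpa using hu i.succ⟩
  refine add_le_add (Finset.card_le_card fun ε hε => ?_) (Finset.card_le_card fun ε hε => ?_)
  · rw [mem_signPatterns]
    rcases Finset.mem_union.1 hε with h | h
    all_goals
      obtain ⟨u, _, hu⟩ := hA h
      exact ⟨u, hu⟩
  · obtain ⟨h1, h2⟩ := Finset.mem_inter.1 hε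
    obtain ⟨u, hu0, hu⟩ := hA h1
    obtain ⟨v, hv0, hv⟩ := hA h2
    simp only [boolSign, if_true, one_mul, Bool.false_eq_true, if_false, neg_mul] at hu0 hv0
    rw [mem_signPatterns]
    -- Both coefficients are positive, so the combination keeps the common signs; it is where the
    -- segment from `u` to `v` meets the kernel, up to scale.
    refine ⟨⟨(-f 0 v) • u + f 0 u • v, ?_⟩, fun i => ?_⟩
    · simp [LinearMap.mem_ker]; ring
    · have h3 := mul_pos hv0 (hu i)
      have h4 := mul_pos hu0 (hv i)
      simp only [LinearMap.domRestrict_apply, map_add, map_smul, smul_eq_mul]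
      nlinarith

theorem sum_range_choose_succ_eq (n d : ℕ) :
    ∑ i ∈ Finset.range (d + 1), (n + 1).choose i =
      ∑ i ∈ Finset.range (d + 1), n.choose i + ∑ i ∈ Finset.range d, n.choose i := by
  rw [Finset.sum_range_succ' (fun i => (n + 1).choose i), Finset.sum_range_succ' (fun i => n.choose i)]
  simp only [Nat.choose_succ_succ, Nat.succ_eq_add_one, Finset.sum_add_distrib, Nat.choose_zero_right]
  omega

/-- Schläfli's bound for the number of regions of a central hyperplane arrangement. -/
theorem card_signPatterns_le (n : ℕ) : ∀ {V : Type*} [AddCommGroup V] [Module ℝ V]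
    [FiniteDimensional ℝ V] (f : Fin (n + 1) → V →ₗ[ℝ] ℝ),
    (signPatterns f).card ≤ 2 * ∑ i ∈ Finset.range (Module.finrank ℝ V), n.choose i := by
  induction n with
  | zero =>
    intro V _ _ _ f
    by_cases h0 : f 0 = 0
    · simp [signPatterns_eq_empty h0]
    have hd : 0 < Module.finrank ℝ V := by
      obtain ⟨v, hv⟩ : ∃ v, f 0 v ≠ 0 := by
        by_contra! h; exact h0 (LinearMap.ext h)
      have : Nontrivial V := ⟨v, 0, fun h => hv (by simp [h])⟩
      exact Module.finrank_pos
    obtain ⟨e, he⟩ := Nat.exists_eq_succ_of_ne_zero hd.ne'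
    rw [he, Finset.sum_range_succ']
    have := Finset.card_le_univ (signPatterns f)
    simp at this ⊢
    omega
  | succ n ih =>
    intro V _ _ _ f
    by_cases h0 : f 0 = 0
    · simp [signPatterns_eq_empty h0]
    have hker : Module.finrank ℝ (LinearMap.ker (f 0)) + 1 = Module.finrank ℝ V := by
      exact Module.Dual.finrank_ker_add_one_of_ne_zero h0
    have h1 := card_signPatterns_succ_le f
    have h2 := ih fun i => f i.succ
    have h3 := ih fun i => (f i.succ).domRestrict (LinearMap.ker (f 0))
    -- Pascal's rule for partial sums matches the recursion: deletion keeps the dimension,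
    -- restriction lowers it by one.
    rw [← hker, sum_range_choose_succ_eq]
    rw [← hker] at h2
    omega

end SignPatterns
-- Wendel's inequality.
section Wendel

variable {E : Type*} [NormedAddCommGroup E] [InnerProductSpace ℝ E]

/-- The point `p` lies in no open half-space containing all the points `x i`. -/
def Surrounds {ι : Type*} (p : E) (x : ι → E) : Prop :=
  ¬ ∃ u : E, ∀ i, 0 < inner ℝ u (x i - p)

/-- Otherwise Hahn–Banach strictly separates `p` from the hull, which is closed because `ι` is
finite, and the separating functional supplies `u`. -/
theorem Surrounds.mem_convexHull [CompleteSpace E] {ι : Type*} [Finite ι] {p : E} {x : ι → E}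
    (h : Surrounds p x) : p ∈ convexHull ℝ (Set.range x) := by
  by_contra hp
  obtain ⟨f, c, hfp, hf⟩ := geometric_hahn_banach_point_closed (convex_convexHull ℝ _)
    ((Set.finite_range x).isClosed_convexHull ℝ) hp
  refine h ⟨(InnerProductSpace.toDual ℝ E).symm f, fun i => ?_⟩
  rw [InnerProductSpace.toDual_symm_apply, map_sub]
  linarith [hf (x i) (subset_convexHull ℝ _ (Set.mem_range_self i))]

/-- The complement is an uncountable union over `u`, but of open sets; this is the source of
measurability. -/
theorem isClosed_surrounds {ι : Type*} [Finite ι] (p : E) :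
    IsClosed {x : ι → E | Surrounds p x} := by
  have : {x : ι → E | Surrounds p x} = (⋃ u : E, ⋂ i, {x : ι → E | 0 < inner ℝ u (x i - p)})ᶜ := by
    ext x; simp [Surrounds]
  rw [this, isClosed_compl_iff]
  exact isOpen_iUnion fun u => isOpen_iInter_of_finite fun i =>
    isOpen_lt continuous_const (by fun_prop)

variable [FiniteDimensional ℝ E] [MeasurableSpace E] [BorelSpace E]

theorem measurableSet_surrounds {ι : Type*} [Fintype ι] (p : E) :
    MeasurableSet {x : ι → E | Surrounds p x} :=
  (isClosed_surrounds p).measurableSet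

theorem measurableSet_not_surrounds {ι : Type*} [Fintype ι] (p : E) :
    MeasurableSet {x : ι → E | ¬ Surrounds p x} :=
  (measurableSet_surrounds p).compl

omit [FiniteDimensional ℝ E] [BorelSpace E] in
theorem map_boolSign_smul {ν : Measure E} (hν : ν.map (fun x => -x) = ν) (b : Bool) :
    ν.map (fun x => boolSign b • x) = ν := by
  cases b
  · simpa [boolSign] using hν
  · simp [boolSign]

theorem measureReal_not_surrounds_boolSign {ν : Measure E} [IsProbabilityMeasure ν]
    (hν : ν.map (fun x => -x) = ν) {n : ℕ} (ε : Fin n → Bool) :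
    (Measure.pi fun _ : Fin n => ν).real {x | ¬ Surrounds 0 fun i => boolSign (ε i) • x i} =
      (Measure.pi fun _ : Fin n => ν).real {x | ¬ Surrounds 0 x} := by
  have hm : Measurable fun (x : Fin n → E) i => boolSign (ε i) • x i := by fun_prop
  have hmap : (Measure.pi fun _ : Fin n => ν).map (fun x i => boolSign (ε i) • x i) =
      Measure.pi fun _ : Fin n => ν := by
    have hp : ∀ i, IsProbabilityMeasure (ν.map fun x => boolSign (ε i) • x) := fun i =>
      Measure.isProbabilityMeasure_map (by fun_prop)
    rw [Measure.pi_map_pi (μ := fun _ : Fin n => ν) (f := fun i x => boolSign (ε i) • x)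
      (fun i => by fun_prop)]
    simp_rw [map_boolSign_smul hν]
  conv_rhs => rw [← hmap]
  rw [map_measureReal_apply hm (measurableSet_not_surrounds 0)]
  rfl

-- For fixed points, the signs that put them in an open half-space are exactly the sign patterns of
-- the functionals ⟨x i, ·⟩, so Schläfli's bound holds pointwise.
omit [MeasurableSpace E] [BorelSpace E] in
theorem sum_indicator_not_surrounds_le {n : ℕ} (x : Fin (n + 1) → E) :
    ∑ ε : Fin (n + 1) → Bool, {x : Fin (n + 1) → E |
      ¬ Surrounds 0 fun i => boolSign (ε i) • x i}.indicator (1 : (Fin (n + 1) → E) → ℝ) x ≤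
    2 * ∑ i ∈ Finset.range (Module.finrank ℝ E), (n.choose i : ℝ) := by
  classical
  have h := card_signPatterns_le n fun i => (innerₗ E (x i))
  have h1 : ∑ ε : Fin (n + 1) → Bool, {x : Fin (n + 1) → E |
      ¬ Surrounds 0 fun i => boolSign (ε i) • x i}.indicator (1 : (Fin (n + 1) → E) → ℝ) x =
      ((signPatterns fun i => (innerₗ E (x i))).card : ℝ) := by
    simp only [Set.indicator_apply, Pi.one_apply, Finset.sum_boole, signPatterns]
    norm_cast
    congr 1
    ext ε
    simp [Surrounds, real_inner_smul_right, real_inner_comm]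
  rw [h1]
  exact_mod_cast h

/-- Wendel's inequality for a centrally symmetric distribution. -/
theorem measureReal_not_surrounds_zero_le {ν : Measure E} [IsProbabilityMeasure ν]
    (hν : ν.map (fun x => -x) = ν) (n : ℕ) :
    (Measure.pi fun _ : Fin (n + 1) => ν).real {x | ¬ Surrounds 0 x} ≤
      (2 ^ n : ℝ)⁻¹ * ∑ i ∈ Finset.range (Module.finrank ℝ E), (n.choose i : ℝ) := by
  set μ := Measure.pi fun _ : Fin (n + 1) => ν with hμ
  set B : ℝ := 2 * ∑ i ∈ Finset.range (Module.finrank ℝ E), (n.choose i : ℝ) with hB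
  have hS : ∀ ε : Fin (n + 1) → Bool, MeasurableSet {x : Fin (n + 1) → E |
      ¬ Surrounds 0 fun i => boolSign (ε i) • x i} := fun ε =>
    (measurable_pi_lambda _ fun i => by fun_prop :
      Measurable fun (x : Fin (n + 1) → E) i => boolSign (ε i) • x i)
      (measurableSet_not_surrounds 0)
  have hint : ∀ ε : Fin (n + 1) → Bool, Integrable ({x : Fin (n + 1) → E |
      ¬ Surrounds 0 fun i => boolSign (ε i) • x i}.indicator (1 : (Fin (n + 1) → E) → ℝ)) μ :=
    fun ε => (integrable_const (1 : ℝ)).indicator (hS ε)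
  -- By symmetry all `2 ^ (n + 1)` choices of signs contribute the same probability.
  have h1 : ∫ x, ∑ ε : Fin (n + 1) → Bool, {x : Fin (n + 1) → E |
      ¬ Surrounds 0 fun i => boolSign (ε i) • x i}.indicator (1 : (Fin (n + 1) → E) → ℝ) x ∂μ =
      2 ^ (n + 1) * μ.real {x | ¬ Surrounds 0 x} := by
    rw [integral_finsetSum _ fun ε _ => hint ε]
    simp_rw [integral_indicator_one (hS _), hμ, measureReal_not_surrounds_boolSign hν]
    simp
  have h2 : 2 ^ (n + 1) * μ.real {x | ¬ Surrounds 0 x} ≤ B := by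
    rw [← h1]
    refine (integral_mono (integrable_finsetSum _ fun ε _ => hint ε) (integrable_const B)
      fun x => sum_indicator_not_surrounds_le x).trans ?_
    simp
  rw [inv_mul_eq_div, le_div_iff₀ (by positivity)]
  rw [pow_succ] at h2
  linarith

-- Positive rescaling does not change the sign of an inner product; a point equal to `p` is sent to
-- 0 and has inner product 0 on both sides.
omit [FiniteDimensional ℝ E] [MeasurableSpace E] [BorelSpace E] in
theorem surrounds_zero_inv_norm_smul {ι : Type*} (p : E) (x : ι → E) :
    Surrounds 0 (fun i => ‖x i - p‖⁻¹ • (x i - p)) ↔ Surrounds p x := by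
  simp only [Surrounds, sub_zero, inner_inv_norm_smul_pos_iff]

end Wendel

/-- Wendel's inequality for a balanced distribution. -/
theorem IsBalancedAbout.measureReal_not_surrounds_le {d : ℕ}
    {D : Measure (EuclideanSpace ℝ (Fin d))} [IsProbabilityMeasure D]
    {p : EuclideanSpace ℝ (Fin d)} (hD : IsBalancedAbout D p) (n : ℕ) :
    (Measure.pi fun _ : Fin (n + 1) => D).real {x | ¬ Surrounds p x} ≤
      (2 ^ n : ℝ)⁻¹ * ∑ i ∈ Finset.range d, (n.choose i : ℝ) := by
  have hsub : Measurable fun x : EuclideanSpace ℝ (Fin d) => x - p := by fun_prop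
  have hp1 : IsProbabilityMeasure (D.map fun x => x - p) :=
    Measure.isProbabilityMeasure_map hsub.aemeasurable
  have hbal : ∀ u : EuclideanSpace ℝ (Fin d), (D.map fun x => x - p) {x | 0 < inner ℝ u x} =
      (D.map fun x => x - p) {x | inner ℝ u x < 0} := by
    intro u
    rw [Measure.map_apply hsub (measurableSet_lt (by fun_prop) (by fun_prop)),
      Measure.map_apply hsub (measurableSet_lt (by fun_prop) (by fun_prop))]
    rcases eq_or_ne u 0 with rfl | hu
    · simp
    · exact hD u hu
  have hnrm : Measurable fun x : EuclideanSpace ℝ (Fin d) => ‖x‖⁻¹ • x := by fun_prop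
  have hsymm := map_inv_norm_smul_neg_of_balanced _ hbal
  have hp2 : IsProbabilityMeasure ((D.map fun x => x - p).map fun x => ‖x‖⁻¹ • x) :=
    Measure.isProbabilityMeasure_map hnrm.aemeasurable
  have h := measureReal_not_surrounds_zero_le hsymm n
  have hmap : (Measure.pi fun _ : Fin (n + 1) => (D.map fun x => x - p).map fun x => ‖x‖⁻¹ • x) =
      (Measure.pi fun _ : Fin (n + 1) => D).map fun x i => ‖x i - p‖⁻¹ • (x i - p) := by
    rw [Measure.map_map hnrm hsub] at hp2 ⊢
    rw [Measure.pi_map_pi (μ := fun _ : Fin (n + 1) => D)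
      (f := fun i x => ‖x - p‖⁻¹ • (x - p)) (hμ := fun _ => (inferInstance : SigmaFinite (Measure.map ((fun x : EuclideanSpace ℝ (Fin d) => ‖x‖⁻¹ • x) ∘ fun x => x - p) D)))
      (fun i => by fun_prop)]
    rfl
  rw [hmap, map_measureReal_apply (by fun_prop) (measurableSet_not_surrounds 0),
    finrank_euclideanSpace_fin] at h
  refine (le_of_eq ?_).trans h
  congr 1
  ext x
  exact not_congr (surrounds_zero_inv_norm_smul p x).symm

/-! ### Disjoint blocks of coordinates are independent samples. -/

section ProductMeasures

variable {ι α κ X : Type*} [Fintype α] [Fintype κ] [MeasurableSpace X]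

theorem infinitePi_map_comp (μ : Measure X) [IsProbabilityMeasure μ] {e : α → ι}
    (he : Function.Injective e) :
    (Measure.infinitePi fun _ : ι => μ).map (fun x a => x (e a)) = Measure.pi fun _ : α => μ := by
  have h1 : iIndepFun (fun (i : ι) (x : ι → X) => x i) (Measure.infinitePi fun _ : ι => μ) := by
    rw [iIndepFun_iff_map_fun_eq_infinitePi_map (by fun_prop), Measure.map_id']
    congr
    funext i
    exact ((measurePreserving_eval_infinitePi (fun _ : ι => μ) i).map_eq).symm
  have h2 := (h1.precomp he)
  rw [iIndepFun_iff_map_fun_eq_pi_map (fun a => (measurable_pi_apply (e a)).aemeasurable)] at h2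
  rw [h2]
  congr
  funext a
  exact (measurePreserving_eval_infinitePi (fun _ : ι => μ) (e a)).map_eq

theorem pi_map_comp [Fintype ι] (μ : Measure X) [IsProbabilityMeasure μ] {e : α → ι}
    (he : Function.Injective e) :
    (Measure.pi fun _ : ι => μ).map (fun x a => x (e a)) = Measure.pi fun _ : α => μ := by
  rw [← Measure.infinitePi_eq_pi, infinitePi_map_comp μ he]

theorem pi_map_blocks [Fintype ι] (μ : Measure X) [IsProbabilityMeasure μ] {e : α × κ → ι}
    (he : Function.Injective e) :
    (Measure.pi fun _ : ι => μ).map (fun x a b => x (e (a, b))) =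
      Measure.pi fun _ : α => Measure.pi fun _ : κ => μ := by
  have h := Measure.infinitePi_map_curry (fun (_ : α) (_ : κ) => μ)
  simp only [Measure.infinitePi_eq_pi] at h
  rw [← h, ← pi_map_comp μ he, Measure.map_map (MeasurableEquiv.measurable _) (by fun_prop)]
  rfl

end ProductMeasures

/-! ### Lower tail of the number of successes. -/

section BinomialTail

theorem sum_range_choose_le_two_pow (n : ℕ) : ∀ a, ∑ i ∈ Finset.range a, n.choose i ≤ 2 ^ n := by
  induction n with
  | zero =>
    intro a
    cases a with
    | zero => simp
    | succ a => rw [Finset.sum_range_succ']; simp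
  | succ n ih =>
    intro a
    cases a with
    | zero => simp
    | succ a =>
      rw [sum_range_choose_succ_eq, pow_succ]
      linarith [ih (a + 1), ih a]

-- Condition on the first trial. With success probability q the recursion reads q P(S t) + (1 - q)
-- P(S (t + 1)), which does not increase with q because `S t ⊆ S (t + 1)`. So q = 1/2 is the worst
-- case, and there the bound follows Pascal's rule.
open Classical in
theorem measureReal_card_lt_le {Ω : Type*} [MeasurableSpace Ω] (μ : Measure Ω)
    [IsProbabilityMeasure μ] {A : Set Ω} (hA : MeasurableSet A) (hhalf : 1 / 2 ≤ μ.real A) (N : ℕ) :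
    ∀ t : ℕ, (Measure.pi fun _ : Fin N => μ).real
      {x | (Finset.univ.filter fun i => x i ∈ A).card < t} ≤
        (2 ^ N : ℝ)⁻¹ * ∑ i ∈ Finset.range t, (N.choose i : ℝ) := by
  induction N with
  | zero =>
    intro t
    cases t with
    | zero => simp
    | succ t =>
      rw [Finset.sum_range_succ']
      simp
  | succ N ih =>
    intro t
    cases t with
    | zero => simp
    | succ t =>
      let S : ℕ → Set (Fin N → Ω) := fun t => {x | (Finset.univ.filter fun i => x i ∈ A).card < t}
      have hmp := measurePreserving_piFinSuccAbove (fun _ : Fin (N + 1) => μ) 0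
      have hset : {x : Fin (N + 1) → Ω | (Finset.univ.filter fun i => x i ∈ A).card < t + 1} =
          MeasurableEquiv.piFinSuccAbove (fun _ => Ω) 0 ⁻¹' (A ×ˢ S t ∪ Aᶜ ×ˢ S (t + 1)) := by
        ext x
        have hcard : (Finset.univ.filter fun i => x i ∈ A).card = (if x 0 ∈ A then 1 else 0) +
            (Finset.univ.filter fun i : Fin N => x i.succ ∈ A).card := Fin.card_filter_univ_succ' _
        by_cases h0 : x 0 ∈ A
        · simp [S, hcard, h0, MeasurableEquiv.piFinSuccAbove, Fin.insertNthEquiv, Fin.tail,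
            Nat.add_comm 1]
          congr!
        · simp [S, hcard, h0, MeasurableEquiv.piFinSuccAbove, Fin.insertNthEquiv, Fin.tail]
          congr!
      have hmono : S t ⊆ S (t + 1) := fun x hx => Nat.lt_succ_of_lt hx
      rw [hset, measureReal_def,
        hmp.measure_preimage_equiv, ← measureReal_def]
      refine (measureReal_union_le _ _).trans ?_
      rw [measureReal_prod_prod, measureReal_prod_prod, probReal_compl_eq_one_sub hA]
      have h1 := ih t
      have h2 := ih (t + 1)
      have hsum : ∑ i ∈ Finset.range (t + 1), ((N + 1).choose i : ℝ) =
          ∑ i ∈ Finset.range (t + 1), (N.choose i : ℝ) + ∑ i ∈ Finset.range t, (N.choose i : ℝ) := by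
        exact_mod_cast sum_range_choose_succ_eq N t
      have hle : (Measure.pi fun _ : Fin N => μ).real (S t) ≤
          (Measure.pi fun _ : Fin N => μ).real (S (t + 1)) := measureReal_mono hmono
      rw [hsum, pow_succ, mul_inv]
      change (Measure.pi fun _ : Fin N => μ).real (S t) ≤ _ at h1
      change (Measure.pi fun _ : Fin N => μ).real (S (t + 1)) ≤ _ at h2
      nlinarith

end BinomialTail

/-! ### Surviving the removal of points. -/

section Robust

/-- The point `p` stays in the convex hull of the points `x i` after the removal of any at most `t`
of them. -/
def RobustlySurrounds {V ι : Type*} [AddCommGroup V] [Module ℝ V] (t : ℕ) (p : V) (x : ι → V) :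
    Prop :=
  ∀ R : Finset ι, R.card ≤ t → p ∈ convexHull ℝ (x '' {i | i ∉ R})

variable {E : Type*} [NormedAddCommGroup E] [InnerProductSpace ℝ E]

theorem Surrounds.robustlySurrounds_zero [CompleteSpace E] {ι : Type*} [Finite ι] {p : E}
    {x : ι → E} (h : Surrounds p x) : RobustlySurrounds 0 p x := by
  intro R hR
  have : R = ∅ := by simpa using hR
  simpa [this] using h.mem_convexHull

-- Pigeonhole: the blocks are disjoint, so a set `R` meeting every surrounding block has more than
-- `t` elements.
open Classical in
theorem robustlySurrounds_of_blocks [CompleteSpace E] {ι α κ : Type*} [Fintype α] [Finite κ]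
    {e : α × κ → ι} (he : Function.Injective e) {p : E} {x : ι → E} {t : ℕ}
    (h : t < (Finset.univ.filter fun a => Surrounds p fun b => x (e (a, b))).card) :
    RobustlySurrounds t p x := by
  intro R hR
  obtain ⟨a, ha, hdisj⟩ : ∃ a, (Surrounds p fun b => x (e (a, b))) ∧ ∀ b, e (a, b) ∉ R := by
    by_contra! hcon
    refine absurd (h.trans_le ?_) hR.not_gt
    -- The implication inside the existential makes the choice function total; blocks that do not
    -- surround `p` get an arbitrary label.
    have hcon' : ∀ a, ∃ i, (Surrounds p fun b => x (e (a, b))) → i ∈ R ∧ ∃ b, e (a, b) = i := by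
      intro a
      by_cases ha : Surrounds p fun b => x (e (a, b))
      · obtain ⟨b, hb⟩ := hcon a ha
        exact ⟨e (a, b), fun _ => ⟨hb, b, rfl⟩⟩
      · have hne : Nonempty ι := by
          obtain ⟨a', ha'⟩ := Finset.card_pos.1 (Nat.zero_lt_of_lt h)
          obtain ⟨b, _⟩ := hcon a' (Finset.mem_filter.1 ha').2
          exact ⟨e (a', b)⟩
        exact ⟨Classical.choice hne, fun h' => absurd h' ha⟩
    choose g hg using hcon'
    refine Finset.card_le_card_of_injOn g (fun a ha => (hg a (by simpa using ha)).1) ?_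
    intro a ha a' ha' haa
    obtain ⟨b, hb⟩ := (hg a (by simpa using ha)).2
    obtain ⟨b', hb'⟩ := (hg a' (by simpa using ha')).2
    exact congrArg Prod.fst (he (hb.trans (haa.trans hb'.symm)))
  refine convexHull_mono ?_ ha.mem_convexHull
  rintro _ ⟨b, rfl⟩
  exact ⟨e (a, b), hdisj b, rfl⟩

end Robust

/-! ### Urn throws and colourings of `k` labels. -/

section ThrowsNeeded

theorem urnLoad_mono {m : ℕ} (ω : ℕ → Fin m) {r s : ℕ} (hrs : r ≤ s) (j : Fin m) :
    urnLoad ω r j ≤ urnLoad ω s j :=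
  Finset.card_le_card (Finset.filter_subset_filter _ (Finset.range_mono hrs))

theorem urnLoad_eq_card_fin {m : ℕ} (ω : ℕ → Fin m) (k : ℕ) (j : Fin m) :
    urnLoad ω k j = (Finset.univ.filter fun i : Fin k => ω i = j).card := by
  rw [urnLoad, Finset.card_filter, Finset.card_filter, Finset.sum_range]

theorem throwsNeeded_le_iff {m n k : ℕ} (ω : ℕ → Fin m) :
    throwsNeeded n ω ≤ (k : ℕ∞) ↔
      ∀ j, n ≤ (Finset.univ.filter fun i : Fin k => ω i = j).card := by
  simp_rw [← urnLoad_eq_card_fin]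
  constructor
  · intro h j
    -- A strict bound on the infimum yields an actual number of throws `r ≤ k`.
    have h1 : throwsNeeded n ω < ((k + 1 : ℕ) : ℕ∞) := h.trans_lt (by exact_mod_cast Nat.lt_succ_self k)
    simp only [throwsNeeded, iInf_lt_iff] at h1
    obtain ⟨r, hr, hrk⟩ := h1
    exact (hr j).trans (urnLoad_mono ω (Nat.lt_succ_iff.1 (by exact_mod_cast hrk)) j)
  · intro h
    exact iInf₂_le k h

theorem isProbabilityMeasure_uniformColor {m : ℕ} (hm : 0 < m) :
    IsProbabilityMeasure (uniformColor m) := by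
  have : Nonempty (Fin m) := ⟨⟨0, hm⟩⟩
  exact isProbabilityMeasure_uniformOn Set.finite_univ Set.univ_nonempty

/-- Every colour is used at least `n` times. -/
def IsBalancedColoring {m k : ℕ} (n : ℕ) (c : Fin k → Fin m) : Prop :=
  ∀ j, n ≤ (Finset.univ.filter fun i => c i = j).card

theorem urnThrows_throwsNeeded_le {m : ℕ} (hm : 0 < m) (n k : ℕ) :
    urnThrows m {ω | throwsNeeded n ω ≤ (k : ℕ∞)} =
      (Measure.pi fun _ : Fin k => uniformColor m) {c | IsBalancedColoring n c} := by
  have := isProbabilityMeasure_uniformColor hm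
  rw [← infinitePi_map_comp (uniformColor m) (e := fun i : Fin k => (i : ℕ)) Fin.val_injective,
    Measure.map_apply (by fun_prop) (Set.toFinite _).measurableSet]
  congr 1
  ext ω
  exact throwsNeeded_le_iff ω

end ThrowsNeeded

/-! ### Conditioning on the colouring. -/

section Allocation

variable {d : ℕ} {D : Measure (EuclideanSpace ℝ (Fin d))} [IsProbabilityMeasure D]

theorem IsBalancedColoring.exists_blocks {m k n : ℕ} {c : Fin k → Fin m}
    (hc : IsBalancedColoring n c) :
    ∃ e : Fin m × Fin n → Fin k, Function.Injective e ∧ ∀ j i, c (e (j, i)) = j := by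
  have h : ∀ j : Fin m, ∃ g : Fin n → Fin k, Function.Injective g ∧ ∀ i, c (g i) = j := by
    intro j
    obtain ⟨s, hs, hcard⟩ := Finset.exists_subset_card_eq (hc j)
    refine ⟨fun i => s.orderEmbOfFin hcard i, (s.orderEmbOfFin hcard).injective, fun i => ?_⟩
    simpa using hs (s.orderEmbOfFin_mem hcard i)
  choose g hg hgc using h
  refine ⟨fun q => g q.1 q.2, ?_, fun j i => hgc j i⟩
  rintro ⟨j, i⟩ ⟨j', i'⟩ heq
  have hj : j = j' := by rw [← hgc j i, ← hgc j' i']; exact congrArg c heq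
  subst hj
  exact congrArg (Prod.mk j) (hg j heq)

/-- Each block loses at most `R.card` of its points, so `p` survives in every colour at once. -/
theorem isTverbergWithTolerance_of_blocks {m k n t : ℕ} {ω : ColoredPoints d m k}
    {p : EuclideanSpace ℝ (Fin d)} {e : Fin m × Fin n → Fin k} (he : Function.Injective e)
    (hc : ∀ j i, (ω (e (j, i))).2 = j)
    (hx : ∀ j, RobustlySurrounds t p fun i => (ω (e (j, i))).1) :
    IsTverbergWithTolerance t ω := by
  classical
  intro R hR
  refine ⟨p, Set.mem_iInter.2 fun j => ?_⟩
  have hcard : (Finset.univ.filter fun i => e (j, i) ∈ R).card ≤ t := by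
    refine le_trans (Finset.card_le_card_of_injOn (fun i => e (j, i)) (fun i hi => ?_) ?_) hR
    · simpa using hi
    · intro i _ i' _ h
      exact congrArg Prod.snd (he h)
  refine convexHull_mono ?_ (hx j _ hcard)
  rintro _ ⟨i, hi, rfl⟩
  exact ⟨e (j, i), by simpa using hi, hc j i, rfl⟩

theorem pi_forall_block_mem {m k n : ℕ} {e : Fin m × Fin n → Fin k} (he : Function.Injective e)
    {G : Set (Fin n → EuclideanSpace ℝ (Fin d))} (hG : MeasurableSet G) :
    (Measure.pi fun _ : Fin k => D) {x | ∀ j, (fun i => x (e (j, i))) ∈ G} =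
      (Measure.pi fun _ : Fin n => D) G ^ m := by
  have h := pi_map_blocks D he
  have h2 := congrArg (fun μ => μ (Set.univ.pi fun _ : Fin m => G)) h
  simp only [Measure.pi_pi, Finset.prod_const, Finset.card_univ, Fintype.card_fin] at h2
  rw [← h2, Measure.map_apply (by fun_prop) (MeasurableSet.univ_pi fun _ => hG)]
  congr 1
  ext x
  simp

/-- Given a colouring with at least `n` labels of each colour, the chosen labels form `m`
independent samples, each in `G` with the same probability, whichever such colouring it is.
Integrating over colourings gives the product. -/
theorem randomAllocation_lower_bound {m : ℕ} (hm : 0 < m) (k n t : ℕ)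
    {p : EuclideanSpace ℝ (Fin d)} {G : Set (Fin n → EuclideanSpace ℝ (Fin d))}
    (hG : MeasurableSet G) (hGp : ∀ x ∈ G, RobustlySurrounds t p x) :
    (urnThrows m).real {ω | throwsNeeded n ω ≤ (k : ℕ∞)} *
        (Measure.pi fun _ : Fin n => D).real G ^ m ≤
      (randomAllocation m k D).real {ω | IsTverbergWithTolerance t ω} := by
  classical
  have := isProbabilityMeasure_uniformColor hm
  have hprob : IsProbabilityMeasure (randomAllocation m k D) := by
    unfold randomAllocation; infer_instance
  choose e he hce using fun (c : Fin k → Fin m) (hc : IsBalancedColoring n c) => hc.exists_blocks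
  -- A finite union of measurable rectangles inside the Tverberg event, so that measurability of the
  -- event itself is not needed.
  set T : Set ((Fin k → EuclideanSpace ℝ (Fin d)) × (Fin k → Fin m)) :=
    ⋃ (c : Fin k → Fin m) (hc : IsBalancedColoring n c),
      {x | ∀ j, (fun i => x (e c hc (j, i))) ∈ G} ×ˢ {c} with hT
  have hmeas : ∀ c hc, MeasurableSet {x : Fin k → EuclideanSpace ℝ (Fin d) |
      ∀ j, (fun i => x (e c hc (j, i))) ∈ G} := by
    intro c hc
    have : {x : Fin k → EuclideanSpace ℝ (Fin d) | ∀ j, (fun i => x (e c hc (j, i))) ∈ G} =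
        ⋂ j, (fun x i => x (e c hc (j, i))) ⁻¹' G := by
      ext x; simp
    rw [this]
    exact MeasurableSet.iInter fun j => (by fun_prop : Measurable fun (x : Fin k →
      EuclideanSpace ℝ (Fin d)) i => x (e c hc (j, i))) hG
  have hTm : MeasurableSet T := MeasurableSet.iUnion fun c => MeasurableSet.iUnion fun hc =>
    (hmeas c hc).prod (Set.toFinite _).measurableSet
  have hmp := measurePreserving_arrowProdEquivProdArrow (EuclideanSpace ℝ (Fin d)) (Fin m) (Fin k)
    (fun _ => D) (fun _ => uniformColor m)
  have hsub : MeasurableEquiv.arrowProdEquivProdArrow _ _ _ ⁻¹' T ⊆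
      {ω : ColoredPoints d m k | IsTverbergWithTolerance t ω} := by
    intro ω hω
    simp only [hT, Set.mem_preimage, Set.mem_iUnion, Set.mem_prod, Set.mem_singleton_iff] at hω
    obtain ⟨c, hc, hx, hcol⟩ := hω
    refine isTverbergWithTolerance_of_blocks (he c hc) (fun j i => ?_) fun j => hGp _ (hx j)
    exact (congrFun hcol _).trans (hce c hc j i)
  have hle : (urnThrows m) {ω | throwsNeeded n ω ≤ (k : ℕ∞)} *
      (Measure.pi fun _ : Fin n => D) G ^ m ≤ (randomAllocation m k D)
        {ω | IsTverbergWithTolerance t ω} := by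
    refine le_trans ?_ (measure_mono hsub)
    rw [randomAllocation, hmp.measure_preimage_equiv, Measure.prod_apply_symm hTm,
      urnThrows_throwsNeeded_le hm, mul_comm,
      ← lintegral_indicator_const (Set.toFinite _).measurableSet]
    refine lintegral_mono fun c => ?_
    by_cases hc : IsBalancedColoring n c
    swap
    · simp [hc]
    rw [Set.indicator_of_mem (by exact hc), ← pi_forall_block_mem (he c hc) hG]
    refine measure_mono fun x hx => ?_
    simp only [hT, Set.mem_preimage, Set.mem_iUnion, Set.mem_prod, Set.mem_singleton_iff]
    exact ⟨c, hc, hx, rfl⟩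
  have := ENNReal.toReal_mono (measure_ne_top _ _) hle
  rwa [ENNReal.toReal_mul, ENNReal.toReal_pow] at this

end Allocation

/-! ### The two explicit lower bounds. -/

section LowerBounds

variable {d : ℕ} {D : Measure (EuclideanSpace ℝ (Fin d))} [IsProbabilityMeasure D]
  {p : EuclideanSpace ℝ (Fin d)}

/-- For `2 * d` points Wendel's sum covers exactly the lower half of an odd row of Pascal's
triangle; hence the block size `2 * d`. -/
theorem IsBalancedAbout.half_le_measureReal_surrounds (hD : IsBalancedAbout D p) (hd : 0 < d) :
    1 / 2 ≤ (Measure.pi fun _ : Fin (2 * d) => D).real {x | Surrounds p x} := by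
  obtain ⟨e, rfl⟩ := Nat.exists_eq_succ_of_ne_zero hd.ne'
  have h := hD.measureReal_not_surrounds_le (2 * e + 1)
  have h1 : ∑ i ∈ Finset.range (e + 1), ((2 * e + 1).choose i : ℝ) = 4 ^ e := by
    exact_mod_cast Nat.sum_range_choose_halfway e
  have h2 : (2 ^ (2 * e + 1) : ℝ)⁻¹ * 4 ^ e = 1 / 2 := by
    rw [pow_succ, pow_mul]; norm_num
  have h3 := probReal_compl_eq_one_sub (μ := Measure.pi fun _ : Fin (2 * (e + 1)) => D)
    (measurableSet_surrounds p)
  change _ ≤ (2 ^ (2 * e + 1) : ℝ)⁻¹ * ∑ i ∈ Finset.range (e + 1), _ at h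
  rw [h1, h2] at h
  change (Measure.pi fun _ : Fin (2 * (e + 1)) => D).real {x | Surrounds p x}ᶜ ≤ 1 / 2 at h
  change 1 / 2 ≤ (Measure.pi fun _ : Fin (2 * (e + 1)) => D).real {x | Surrounds p x}
  linarith

open Classical in
theorem IsBalancedAbout.measureReal_blocks_ge (hD : IsBalancedAbout D p) (hd : 0 < d) {n N : ℕ}
    {e : Fin N × Fin (2 * d) → Fin n} (he : Function.Injective e) (t : ℕ) :
    MeasurableSet {x : Fin n → EuclideanSpace ℝ (Fin d) |
      t < (Finset.univ.filter fun a => Surrounds p fun b => x (e (a, b))).card} ∧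
    1 - (2 ^ N : ℝ)⁻¹ * ∑ i ∈ Finset.range (t + 1), (N.choose i : ℝ) ≤
      (Measure.pi fun _ : Fin n => D).real {x |
        t < (Finset.univ.filter fun a => Surrounds p fun b => x (e (a, b))).card} := by
  set F : (Fin n → EuclideanSpace ℝ (Fin d)) → Fin N → Fin (2 * d) → EuclideanSpace ℝ (Fin d) :=
    fun x a b => x (e (a, b)) with hF
  have hFm : Measurable F := by fun_prop
  set S : Set (Fin N → Fin (2 * d) → EuclideanSpace ℝ (Fin d)) :=
    {y | (Finset.univ.filter fun a => y a ∈ {z | Surrounds p z}).card < t + 1} with hS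
  have hSm : MeasurableSet S := by
    have : Measurable fun y : Fin N → Fin (2 * d) → EuclideanSpace ℝ (Fin d) =>
        (Finset.univ.filter fun a => y a ∈ {z | Surrounds p z}).card := by
      simp_rw [Finset.card_filter]
      refine Finset.measurable_sum _ fun a _ => Measurable.ite ?_ measurable_const measurable_const
      exact measurable_pi_apply a (measurableSet_surrounds p)
    exact measurableSet_lt this measurable_const
  have hset : {x : Fin n → EuclideanSpace ℝ (Fin d) |
      t < (Finset.univ.filter fun a => Surrounds p fun b => x (e (a, b))).card} = (F ⁻¹' S)ᶜ := by
    ext x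
    simp [hS, hF]
  have hSF : MeasurableSet (F ⁻¹' S) := hFm hSm
  rw [hset]
  refine ⟨hSF.compl, ?_⟩
  rw [probReal_compl_eq_one_sub hSF, ← map_measureReal_apply hFm hSm, hF, pi_map_blocks D he]
  exact sub_le_sub_left (measureReal_card_lt_le _ (measurableSet_surrounds p)
    (hD.half_le_measureReal_surrounds hd) N (t + 1)) 1

theorem IsBalancedAbout.tverbergWithTolerance_lower_bound (hD : IsBalancedAbout D p) (hd : 0 < d)
    {m : ℕ} (hm : 0 < m) (k n t : ℕ) :
    (urnThrows m).real {ω | throwsNeeded n ω ≤ (k : ℕ∞)} *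
        (1 - (2 : ℝ) ^ (-((n / (2 * d) : ℕ) : ℤ)) *
          ∑ i ∈ Finset.range (t + 1), ((n / (2 * d)).choose i : ℝ)) ^ m ≤
      (randomAllocation m k D).real {ω | IsTverbergWithTolerance t ω} := by
  classical
  set N := n / (2 * d) with hN
  have hNn : N * (2 * d) ≤ n := Nat.div_mul_le_self _ _
  set e : Fin N × Fin (2 * d) → Fin n := fun q => Fin.castLE hNn (finProdFinEquiv q)
  have he : Function.Injective e :=
    (Fin.castLE_injective hNn).comp finProdFinEquiv.injective
  obtain ⟨hG, hq⟩ := hD.measureReal_blocks_ge hd he t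
  refine le_trans ?_ (randomAllocation_lower_bound hm k n t hG
    fun x hx => robustlySurrounds_of_blocks he hx)
  rw [zpow_neg, zpow_natCast]
  -- Taking `m`-th powers needs a nonnegative base, which holds since a partial row sum is at most
  -- `2 ^ N`.
  refine mul_le_mul_of_nonneg_left (pow_le_pow_left₀ ?_ hq m) measureReal_nonneg
  rw [sub_nonneg, inv_mul_le_one₀ (by positivity)]
  exact_mod_cast sum_range_choose_le_two_pow N (t + 1)

theorem isTverbergWithTolerance_zero_iff {m k : ℕ} {ω : ColoredPoints d m k} :
    IsTverbergWithTolerance 0 ω ↔ IsTverberg ω := by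
  simp [IsTverbergWithTolerance, IsTverberg]

theorem IsBalancedAbout.tverberg_lower_bound (hD : IsBalancedAbout D p)
    {m : ℕ} (hm : 0 < m) (k n : ℕ) :
    (urnThrows m).real {ω | throwsNeeded (n + 1) ω ≤ (k : ℕ∞)} *
        (1 - (2 ^ n : ℝ)⁻¹ * ∑ i ∈ Finset.range d, (n.choose i : ℝ)) ^ m ≤
      (randomAllocation m k D).real {ω | IsTverberg ω} := by
  have h := randomAllocation_lower_bound (D := D) hm k (n + 1) 0 (measurableSet_surrounds p)
    fun x hx => hx.robustlySurrounds_zero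
  simp only [isTverbergWithTolerance_zero_iff] at h
  refine le_trans ?_ h
  refine mul_le_mul_of_nonneg_left (pow_le_pow_left₀ ?_ ?_ m) measureReal_nonneg
  · rw [sub_nonneg, inv_mul_le_one₀ (by positivity)]
    exact_mod_cast sum_range_choose_le_two_pow n d
  · have h1 := hD.measureReal_not_surrounds_le n
    have h3 := probReal_compl_eq_one_sub (μ := Measure.pi fun _ : Fin (n + 1) => D)
      (measurableSet_surrounds p)
    change (Measure.pi fun _ : Fin (n + 1) => D).real {x | Surrounds p x}ᶜ ≤ _ at h1
    linarith

end LowerBounds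
-- The limit of many colours.
section Asymptotics

theorem integral_uniformColor {m : ℕ} (hm : 0 < m) (f : Fin m → ℝ) :
    ∫ j, f j ∂uniformColor m = (∑ j, f j) / m := by
  have := isProbabilityMeasure_uniformColor hm
  have h : ∀ j, (uniformColor m).real {j} = (m : ℝ)⁻¹ := by
    intro j
    rw [measureReal_def, uniformColor, uniformOn_univ]
    simp
  rw [integral_fintype (Integrable.of_finite)]
  simp_rw [h, smul_eq_mul, ← Finset.mul_sum]
  rw [inv_mul_eq_div]

/-- Chernoff with base 1/2: the indicator is at most 2^n (1/2)^load, and the expectation of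
(1/2)^load is (1 - 1/(2m))^k ≤ exp(-k/(2m)). -/
theorem measureReal_card_lt_le_exp {m : ℕ} (hm : 0 < m) (k n : ℕ) (j : Fin m) :
    (Measure.pi fun _ : Fin k => uniformColor m).real
      {c | (Finset.univ.filter fun i => c i = j).card < n} ≤
        2 ^ n * Real.exp (-(k / (2 * m))) := by
  have := isProbabilityMeasure_uniformColor hm
  have hm' : (0 : ℝ) < m := by exact_mod_cast hm
  set P := Measure.pi fun _ : Fin k => uniformColor m
  set g : Fin m → ℝ := fun a => if a = j then 1 / 2 else 1 with hg
  have hg1 : ∫ a, g a ∂uniformColor m ≤ Real.exp (-(1 / (2 * m))) := by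
    have hsum : ∑ a, g a = m - 1 / 2 := by
      have : ∀ a, g a = 1 - if a = j then 1 / 2 else 0 := by
        intro a; simp only [hg]; split_ifs <;> norm_num
      simp_rw [this]
      simp
    rw [integral_uniformColor hm, hsum]
    refine le_trans (le_of_eq ?_) (Real.one_sub_le_exp_neg _)
    field_simp
  have hg0 : 0 ≤ ∫ a, g a ∂uniformColor m :=
    integral_nonneg fun a => by simp only [hg, Pi.zero_apply]; split_ifs <;> norm_num
  have hint : ∫ c, 2 ^ n * ∏ i, g (c i) ∂P ≤ 2 ^ n * Real.exp (-(k / (2 * m))) := by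
    rw [integral_const_mul, integral_fintype_prod_eq_pow g, Fintype.card_fin]
    refine mul_le_mul_of_nonneg_left ((pow_le_pow_left₀ hg0 hg1 k).trans (le_of_eq ?_))
      (by positivity)
    rw [← Real.exp_nat_mul]
    congr 1; ring
  refine le_trans ?_ hint
  rw [← integral_indicator_one (Set.toFinite _).measurableSet]
  refine integral_mono (Integrable.of_finite) (Integrable.of_finite) fun c => ?_
  have hprod : ∏ i, g (c i) = (1 / 2) ^ (Finset.univ.filter fun i => c i = j).card := by
    simp only [hg]
    rw [Finset.prod_ite]
    simp
  rw [hprod]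
  refine Set.indicator_apply_le' (fun hc => ?_) fun _ => by positivity
  have hc' : (Finset.univ.filter fun i => c i = j).card ≤ n := le_of_lt hc
  obtain ⟨r, hr⟩ := Nat.exists_eq_add_of_le hc'
  rw [Pi.one_apply, hr, pow_add, mul_right_comm, ← mul_pow]
  norm_num
  exact one_le_pow₀ one_le_two

/-- With high probability every urn receives `n` balls after `k` throws. -/
theorem urnThrows_throwsNeeded_ge {m : ℕ} (hm : 0 < m) (k n : ℕ) :
    1 - m * (2 ^ n * Real.exp (-(k / (2 * m)))) ≤
      (urnThrows m).real {ω | throwsNeeded n ω ≤ (k : ℕ∞)} := by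
  have := isProbabilityMeasure_uniformColor hm
  set P := Measure.pi fun _ : Fin k => uniformColor m
  rw [measureReal_def, urnThrows_throwsNeeded_le hm, ← measureReal_def]
  have hcompl := probReal_compl_eq_one_sub (μ := P)
    (Set.toFinite {c : Fin k → Fin m | IsBalancedColoring n c}).measurableSet
  have hunion : {c : Fin k → Fin m | IsBalancedColoring n c}ᶜ ⊆
      ⋃ j, {c | (Finset.univ.filter fun i => c i = j).card < n} := by
    intro c hc
    simpa [IsBalancedColoring] using hc
  have h1 : P.real {c : Fin k → Fin m | IsBalancedColoring n c}ᶜ ≤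
      m * (2 ^ n * Real.exp (-(k / (2 * m)))) := by
    refine (measureReal_mono hunion).trans ((measureReal_iUnion_fintype_le _).trans ?_)
    refine (Finset.sum_le_sum fun j _ => measureReal_card_lt_le_exp hm k n j).trans ?_
    simp
  linarith

theorem sum_range_choose_le_mul_pow {n : ℕ} (hn : 0 < n) (d : ℕ) :
    ∑ i ∈ Finset.range d, n.choose i ≤ d * n ^ d := by
  refine (Finset.sum_le_card_nsmul _ _ (n ^ d) fun i hi => ?_).trans (by simp)
  exact (Nat.choose_le_pow n i).trans
    (Nat.pow_le_pow_right hn (Finset.mem_range.1 hi).le)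

theorem tendsto_clog_two : Tendsto (Nat.clog 2) atTop atTop := by
  refine tendsto_atTop.2 fun b => ?_
  filter_upwards [eventually_ge_atTop (2 ^ b)] with m hm
  rw [← Nat.clog_pow 2 b one_lt_two]
  exact Nat.clog_mono_right 2 hm

/-- The iterated logarithm eventually exceeds 8, and log₂ m ≥ ln m. This weaker growth is all the
limit needs. -/
theorem eventually_mul_log_le {f : ℕ → ℕ}
    (hf : (fun m : ℕ => (m : ℝ) * Real.logb 2 m * Real.log (Real.log m)) =o[atTop]
      fun m : ℕ => (f m : ℝ)) :
    ∀ᶠ m : ℕ in atTop, 8 * (m : ℝ) * Real.log m ≤ f m := by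
  have hlog : Tendsto (fun m : ℕ => Real.log (Real.log m)) atTop atTop :=
    Real.tendsto_log_atTop.comp (Real.tendsto_log_atTop.comp tendsto_natCast_atTop_atTop)
  filter_upwards [hf.bound one_pos, hlog.eventually_ge_atTop 8, eventually_ge_atTop 1]
    with m h1 h2 h3
  have hm : (1 : ℝ) ≤ m := by exact_mod_cast h3
  have hl : 0 ≤ Real.log m := Real.log_nonneg hm
  have hb : Real.log m ≤ Real.logb 2 m := by
    rw [Real.logb, le_div_iff₀ (Real.log_pos one_lt_two)]
    nlinarith [Real.log_two_lt_d9]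
  rw [one_mul, Real.norm_eq_abs, Real.norm_of_nonneg (Nat.cast_nonneg _)] at h1
  have h4 := (le_abs_self _).trans h1
  have h5 : (m : ℝ) * Real.log m ≤ m * Real.logb 2 m := by gcongr
  have h6 : 0 ≤ (m : ℝ) * Real.log m := by positivity
  nlinarith

/-- The union bound is at most m · 8m² · m⁻⁴ = 8/m: rounding gives `2 ^ Nat.clog 2 m ≤ 2 * m`, and
`f m ≥ 8 * m * log m` makes the exponential at most m⁻⁴. -/
theorem tendsto_throwsNeeded_clog {f : ℕ → ℕ}
    (hf : (fun m : ℕ => (m : ℝ) * Real.logb 2 m * Real.log (Real.log m)) =o[atTop]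
      fun m : ℕ => (f m : ℝ)) :
    Tendsto (fun m : ℕ => (urnThrows m).real
      {ω | throwsNeeded (2 * Nat.clog 2 m + 1) ω ≤ (f m : ℕ∞)}) atTop (𝓝 1) := by
  have hlim : Tendsto (fun m : ℕ => (1 : ℝ) - 8 / m) atTop (𝓝 1) := by
    simpa using tendsto_const_nhds.sub (tendsto_const_div_atTop_nhds_zero_nat (8 : ℝ))
  refine tendsto_of_tendsto_of_tendsto_of_le_of_le' hlim tendsto_const_nhds ?_ ?_
  · filter_upwards [eventually_mul_log_le hf, eventually_ge_atTop 2] with m h1 h2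
    have hm : (0 : ℝ) < m := by exact_mod_cast (by omega : 0 < m)
    refine le_trans ?_ (urnThrows_throwsNeeded_ge (by omega) _ _)
    refine sub_le_sub_left ?_ 1
    have hL : (2 : ℝ) ^ Nat.clog 2 m ≤ 2 * m := by
      have h3 := Nat.pow_pred_clog_lt_self one_lt_two (show 1 < m by omega)
      have h4 : Nat.clog 2 m = (Nat.clog 2 m).pred + 1 :=
        (Nat.succ_pred_eq_of_pos (Nat.clog_pos one_lt_two h2)).symm
      rw [h4, pow_succ]
      have : (2 : ℝ) ^ (Nat.clog 2 m).pred ≤ m := by exact_mod_cast h3.le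
      linarith
    have hpow : (2 : ℝ) ^ (2 * Nat.clog 2 m + 1) ≤ 8 * m ^ 2 := by
      rw [pow_succ, mul_comm 2 (Nat.clog 2 m), pow_mul]
      have := pow_le_pow_left₀ (by positivity) hL 2
      linarith
    have hexp : Real.exp (-(f m / (2 * m))) ≤ ((m : ℝ) ^ 4)⁻¹ := by
      rw [Real.exp_neg]
      refine inv_anti₀ (by positivity) ?_
      rw [← Real.exp_log (by positivity : (0 : ℝ) < m ^ 4), Real.log_pow]
      refine Real.exp_le_exp.2 ?_
      rw [le_div_iff₀ (by positivity)]
      push_cast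
      linarith
    calc (m : ℝ) * (2 ^ (2 * Nat.clog 2 m + 1) * Real.exp (-(f m / (2 * m))))
        ≤ m * (8 * m ^ 2 * ((m : ℝ) ^ 4)⁻¹) := by gcongr
      _ = 8 / m := by field_simp
  · filter_upwards [eventually_ge_atTop 1] with m hm
    have := isProbabilityMeasure_uniformColor hm
    have : IsProbabilityMeasure (urnThrows m) := by unfold urnThrows; infer_instance
    exact measureReal_le_one

/-- With L = `Nat.clog 2 m`, one factor 2^(-L) absorbs `m ≤ 2 ^ L` and the other beats the binomial
sum, which is polynomial in L; hence the 2 in `2 * Nat.clog 2 m`. -/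
theorem tendsto_mul_wendel_clog (d : ℕ) :
    Tendsto (fun m : ℕ => (m : ℝ) * ((2 ^ (2 * Nat.clog 2 m) : ℝ)⁻¹ *
      ∑ i ∈ Finset.range d, ((2 * Nat.clog 2 m).choose i : ℝ))) atTop (𝓝 0) := by
  have h1 : Tendsto (fun L : ℕ => (d * 2 ^ d : ℝ) * ((L : ℝ) ^ d / 2 ^ L)) atTop (𝓝 0) := by
    simpa using (tendsto_pow_const_div_const_pow_of_one_lt d (one_lt_two (α := ℝ))).const_mul
      (d * 2 ^ d : ℝ)
  refine squeeze_zero' (Eventually.of_forall fun m => by positivity) ?_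
    (h1.comp tendsto_clog_two)
  filter_upwards [eventually_ge_atTop 2] with m hm
  have hL : 0 < Nat.clog 2 m := Nat.clog_pos one_lt_two hm
  have hmL : (m : ℝ) ≤ 2 ^ Nat.clog 2 m := by exact_mod_cast Nat.le_pow_clog one_lt_two m
  have hsum : ∑ i ∈ Finset.range d, ((2 * Nat.clog 2 m).choose i : ℝ) ≤
      d * (2 * Nat.clog 2 m) ^ d := by
    exact_mod_cast sum_range_choose_le_mul_pow (by omega : 0 < 2 * Nat.clog 2 m) d
  calc (m : ℝ) * ((2 ^ (2 * Nat.clog 2 m) : ℝ)⁻¹ *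
        ∑ i ∈ Finset.range d, ((2 * Nat.clog 2 m).choose i : ℝ))
      ≤ 2 ^ Nat.clog 2 m * ((2 ^ (2 * Nat.clog 2 m) : ℝ)⁻¹ * (d * (2 * Nat.clog 2 m) ^ d)) := by
        gcongr
    _ = _ := by
        simp only [Function.comp_apply]
        rw [two_mul (Nat.clog 2 m), pow_add, mul_pow]
        field_simp

theorem IsBalancedAbout.tendsto_tverberg {d : ℕ} {D : Measure (EuclideanSpace ℝ (Fin d))}
    [IsProbabilityMeasure D] {p : EuclideanSpace ℝ (Fin d)} (hD : IsBalancedAbout D p) {f : ℕ → ℕ}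
    (hf : (fun m : ℕ => (m : ℝ) * Real.logb 2 m * Real.log (Real.log m)) =o[atTop]
      fun m : ℕ => (f m : ℝ)) :
    Tendsto (fun m : ℕ => (randomAllocation m (f m) D).real {ω | IsTverberg ω}) atTop (𝓝 1) := by
  have hw := tendsto_mul_wendel_clog d
  have hlow := (tendsto_throwsNeeded_clog hf).mul (hw.const_sub 1)
  rw [sub_zero, mul_one] at hlow
  refine tendsto_of_tendsto_of_tendsto_of_le_of_le' hlow tendsto_const_nhds ?_ ?_
  · filter_upwards [hw.eventually_le_const one_pos, eventually_ge_atTop 1] with m h1 hm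
    refine le_trans ?_ (hD.tverberg_lower_bound hm (f m) (2 * Nat.clog 2 m))
    refine mul_le_mul_of_nonneg_left ?_ measureReal_nonneg
    set a : ℝ := (2 ^ (2 * Nat.clog 2 m) : ℝ)⁻¹ *
      ∑ i ∈ Finset.range d, ((2 * Nat.clog 2 m).choose i : ℝ)
    have ha0 : 0 ≤ a := by positivity
    have hm1 : (1 : ℝ) ≤ m := by exact_mod_cast hm
    -- Bernoulli's inequality: (1 - a)^m ≥ 1 - m a.
    have := one_add_mul_le_pow (show -2 ≤ -a by nlinarith) m
    rw [← sub_eq_add_neg] at this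
    linarith
  · filter_upwards [eventually_ge_atTop 1] with m hm
    have := isProbabilityMeasure_uniformColor hm
    have : IsProbabilityMeasure (randomAllocation m (f m) D) := by
      unfold randomAllocation; infer_instance
    exact measureReal_le_one

end Asymptotics
end StochasticTverberg

/-! ### Assembly of the three statements. -/

theorem corollary3p6 (d : ℕ) (hd : 0 < d)
    (D : Measure (EuclideanSpace ℝ (Fin d))) [IsProbabilityMeasure D]
    (hD : ∃ p : EuclideanSpace ℝ (Fin d), StochasticTverberg.IsBalancedAbout D p) :
    (∀ (m k n t : ℕ), 0 < m → 0 < n →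
      (StochasticTverberg.urnThrows m).real
            {ω | StochasticTverberg.throwsNeeded n ω ≤ (k : ℕ∞)} *
          (1 - (2 : ℝ) ^ (-((n / (2 * d) : ℕ) : ℤ)) *
            ∑ i ∈ Finset.range (t + 1), ((n / (2 * d)).choose i : ℝ)) ^ m ≤
        (StochasticTverberg.randomAllocation m k D).real
          {ω | StochasticTverberg.IsTverbergWithTolerance t ω}) ∧
    (∀ (m k n : ℕ), 0 < m → 0 < n →
      (StochasticTverberg.urnThrows m).real
            {ω | StochasticTverberg.throwsNeeded n ω ≤ (k : ℕ∞)} *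
          (1 - (2 : ℝ) ^ (-(n : ℤ) + 1) *
            ∑ i ∈ Finset.range d, ((n - 1).choose i : ℝ)) ^ m ≤
        (StochasticTverberg.randomAllocation m k D).real
          {ω | StochasticTverberg.IsTverberg ω}) ∧
    (∀ f : ℕ → ℕ,
      (fun m : ℕ => (m : ℝ) * Real.logb 2 m * Real.log (Real.log m)) =o[atTop]
          (fun m : ℕ => (f m : ℝ)) →
        Tendsto
          (fun m : ℕ => (StochasticTverberg.randomAllocation m (f m) D).real
            {ω | StochasticTverberg.IsTverberg ω})
          atTop (𝓝 1)) := by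
  obtain ⟨p, hD⟩ := hD
  refine ⟨fun m k n t hm _ => hD.tverbergWithTolerance_lower_bound hd hm k n t,
    fun m k n hm hn => ?_, fun f hf => hD.tendsto_tverberg hf⟩
  obtain ⟨n, rfl⟩ := Nat.exists_eq_succ_of_ne_zero hn.ne'
  have h := hD.tverberg_lower_bound hm k n
  have h1 : (2 : ℝ) ^ (-((n + 1 : ℕ) : ℤ) + 1) = (2 ^ n : ℝ)⁻¹ := by
    rw [← zpow_natCast, ← zpow_neg]
    congr 1
    push_cast
    ring
  rw [Nat.succ_eq_add_one, h1, Nat.add_sub_cancel]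
  exact h
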